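/- Let $f:\mathbb{R}^2\to\mathbb{R}^2$ be a $C^1$ function. Let $S=\{z\in\mathbb{R}^2: J_f(z)=0\}$ be its critical set, where $J_f$ is the Jacobian determinant of $f$; let $C(f,\infty)$ be the set of all $w\in\mathbb{R}^2$ for which there is a sequence $\{z_n\}\subset\mathbb{R}^2$ with $z_n\to\infty$ and $f(z_n)\to w$; and let $Val(f,w)=\#\{z\in\mathbb{R}^2: f(z)=w\}$ be the number (possibly infinite) of distinct preimages of $w$. A set $U\subseteq\mathbb{R}^2$ is called uniformly locally arcwise connected if for each $\eta>0$ there exists $\delta>0$ such that any two distinct points $z_1,z_2\in U$ with $|z_1-z_2|<\delta$ are joined by an arc contained in $U$ of diameter less than $\eta$. Suppose that $S$ is nowhere dense, and let $w_0\in C(f,\infty)$ be such that either (i) $Val(f,w_0)<\infty$, or (ii) $Val(f,w_0)=\infty$ and $w_0\notin f(S)$. Suppose that there exists $\epsilon>0$ such that, with $B(w_0,\epsilon)=\{w:|w-w_0|<\epsilon\}$: 1. $C(f,\infty)$ is nowhere dense in $B(w_0,\epsilon)$; and 2. $B(w_0,\epsilon)\setminus(f(S)\cup C(f,\infty))$ has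 only finitely many connected components, each of which is uniformly locally arcwise connected. Then $w_0$ is an asymptotic value of $f$: there exists a continuous curve $\gamma:[0,\infty)\to\mathbb{R}^2$ such that $\gamma(t)\to\infty$ and $f(\gamma(t))\to w_0$ as $t\to\infty$. -/

import Mathlib

open Set Filter Topology

/-- The Euclidean plane `ℝ²`. -/
abbrev Plane : Type := EuclideanSpace ℝ (Fin 2)

/-- The critical set of a map of the plane: the points where its Jacobian determinant vanishes. -/
def criticalSet (f : Plane → Plane) : Set Plane :=
  {z | (fderiv ℝ f z).det = 0}

/-- The cluster set at infinity `C(f, ∞)`: all finite limits of `f (z n)` along sequences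
`z n → ∞`. -/
def clusterSet (f : Plane → Plane) : Set Plane :=
  {w | ∃ z : ℕ → Plane, Tendsto z atTop (Bornology.cobounded Plane) ∧
    Tendsto (fun n => f (z n)) atTop (𝓝 w)}

/-- The valence of `f` at `w`: the number of distinct preimages of `w`, possibly infinite. -/
noncomputable def valence (f : Plane → Plane) (w : Plane) : ℕ∞ :=
  (f ⁻¹' {w}).encard

/-- `w` is an asymptotic value of `f`: there is a curve, continuous on `[0, ∞)`, which tends to
infinity and along which `f` tends to `w`. -/
def IsAsymptoticValue (f : Plane → Plane) (w : Plane) : Prop :=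
  ∃ γ : ℝ → Plane, ContinuousOn γ (Ici 0) ∧
    Tendsto γ atTop (Bornology.cobounded Plane) ∧
    Tendsto (fun t => f (γ t)) atTop (𝓝 w)

/-- Uniform local arcwise connectedness: any two distinct points of `U` that are close enough are
joined by an arc (an injective path) in `U` of small diameter. -/
def UniformlyLocallyArcwiseConnected (U : Set Plane) : Prop :=
  ∀ ε > 0, ∃ δ > 0, ∀ x ∈ U, ∀ y ∈ U, x ≠ y → dist x y < δ →
    ∃ γ : Path x y, Function.Injective γ ∧ range γ ⊆ U ∧ Metric.diam (range γ) < ε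

/-- The set of connected components of a subset `F` of the plane. -/
def componentsOf (F : Set Plane) : Set (Set Plane) :=
  {V | ∃ x ∈ F, V = connectedComponentIn F x}

/-!
The values in the ball around `w₀` that are neither critical values nor cluster values at infinity
form an open set `F`, over which `f` is a proper local homeomorphism and hence a covering map with
finite fibres (`isCoveringMapOn_of_disjoint`, `finite_fiber_of_disjoint`). By Sard's theorem `F` is
dense in the ball, and since the critical set is nowhere dense, `w₀` is approached by images of
points `z n → ∞` with `f (z n) ∈ F` (`frequently_mem_regular`). As `F` has finitely many components,
all `f (z n)` may be taken in a single component `V`. Uniform local arcwise connectedness joins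
consecutive points `f (z n)` of a subsequence by arcs in `V` with diameters tending to `0`, which
gives a curve `β` in `V` ending at `w₀` (`UniformlyLocallyArcwiseConnected.exists_curve`).

The curve `β` has only finitely many lifts, and every `z n` lies on one of them, so some lift `γ`
passes through infinitely many `z n` (`IsCoveringMapOn.exists_lift_frequently_eq`). Along `γ` the
map tends to `w₀`, and `γ` is unbounded. Both hypotheses on the valence make the fibre over `w₀`
countable, so that arbitrarily large circles around the origin miss it; a curve that returned to a
bounded region infinitely often would cross such a circle infinitely often, and the crossings would
accumulate at a point of the fibre. Therefore `γ` tends to infinity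
(`tendsto_cobounded_of_countable_fiber`).
-/

/-! ### Cluster values at infinity -/

instance : (Bornology.cobounded Plane).IsCountablyGenerated := by
  rw [← comap_norm_atTop]; infer_instance

lemma mem_clusterSet_iff {f : Plane → Plane} {w : Plane} :
    w ∈ clusterSet f ↔ MapClusterPt w (Bornology.cobounded Plane) f := by
  constructor
  · rintro ⟨z, hz, hfz⟩
    exact MapClusterPt.of_comp hz hfz.mapClusterPt
  · intro h
    have : (Bornology.cobounded Plane ⊓ comap f (𝓝 w)).NeBot := by
      rw [inf_comm, ← map_neBot_iff f, Filter.push_pull']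
      exact h
    obtain ⟨z, hz⟩ := exists_seq_tendsto (Bornology.cobounded Plane ⊓ comap f (𝓝 w))
    rw [tendsto_inf, tendsto_comap_iff] at hz
    exact ⟨z, hz.1, hz.2⟩

lemma isClosed_clusterSet (f : Plane → Plane) : IsClosed (clusterSet f) := by
  have : clusterSet f = {w | ClusterPt w (map f (Bornology.cobounded Plane))} := by
    ext w; exact mem_clusterSet_iff
  rw [this]
  exact isClosed_setOfPred_clusterPt

/-- Away from its cluster set at infinity, a continuous map is proper. -/
lemma isCompact_preimage_of_disjoint_clusterSet {f : Plane → Plane} (hf : Continuous f)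
    {K : Set Plane} (hK : IsCompact K) (hd : Disjoint K (clusterSet f)) :
    IsCompact (f ⁻¹' K) := by
  refine Metric.isCompact_of_isClosed_isBounded (hK.isClosed.preimage hf) ?_
  by_contra hb
  rw [Bornology.isBounded_def] at hb
  have hfr : ∃ᶠ z in Bornology.cobounded Plane, f z ∈ K := fun h => hb h
  obtain ⟨z, hz, hzK⟩ := exists_seq_forall_of_frequently hfr
  obtain ⟨w, hwK, φ, hφ, hlim⟩ := hK.tendsto_subseq hzK
  exact hd.le_bot ⟨hwK, z ∘ φ, hz.comp hφ.tendsto_atTop, hlim⟩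

lemma isClosed_criticalSet {f : Plane → Plane} (hf : ContDiff ℝ 1 f) :
    IsClosed (criticalSet f) :=
  isClosed_eq (ContinuousLinearMap.continuous_det.comp (hf.continuous_fderiv one_ne_zero))
    continuous_const

/-- Critical values can only accumulate at critical values or at cluster values at infinity. -/
lemma isClosed_image_criticalSet_union_clusterSet {f : Plane → Plane} (hf : ContDiff ℝ 1 f) :
    IsClosed (f '' criticalSet f ∪ clusterSet f) := by
  refine isClosed_of_closure_subset fun w hw => ?_
  obtain ⟨u, hu, hlim⟩ := mem_closure_iff_seq_limit.1 hw
  by_contra hwn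
  rw [mem_union, not_or] at hwn
  have hev := hlim.eventually ((isClosed_clusterSet f).isOpen_compl.mem_nhds hwn.2)
  obtain ⟨r, hr, hball⟩ := Metric.nhds_basis_closedBall.mem_iff.1
    ((isClosed_clusterSet f).isOpen_compl.mem_nhds hwn.2)
  have hcomp := isCompact_preimage_of_disjoint_clusterSet hf.continuous
    (isCompact_closedBall w r) (disjoint_left.2 fun x hx => hball hx)
  have himg : IsClosed (f '' (criticalSet f ∩ f ⁻¹' Metric.closedBall w r)) :=
    ((hcomp.inter_left (isClosed_criticalSet hf)).image hf.continuous).isClosed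
  have : w ∈ f '' (criticalSet f ∩ f ⁻¹' Metric.closedBall w r) := by
    refine himg.mem_of_tendsto hlim ?_
    filter_upwards [hev, hlim.eventually (Metric.closedBall_mem_nhds w hr)] with n h1 h2
    obtain ⟨z, hz, hzu⟩ := (hu n).resolve_right h1
    exact ⟨z, ⟨hz, by rwa [mem_preimage, hzu]⟩, hzu⟩
  exact hwn.1 (image_mono inter_subset_left this)

/-! ### The covering over the regular values -/

/-- The inverse function theorem, in terms of the determinant of the derivative. -/
lemma ContDiff.isLocalHomeomorphOn_of_det_ne_zero {E : Type*} [NormedAddCommGroup E]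
    [NormedSpace ℝ E] [FiniteDimensional ℝ E] {f : E → E} (hf : ContDiff ℝ 1 f) {s : Set E}
    (hs : ∀ z ∈ s, (fderiv ℝ f z).det ≠ 0) : IsLocalHomeomorphOn f s := by
  intro z hz
  have := FiniteDimensional.complete ℝ E
  have hd : HasFDerivAt f
      ((fderiv ℝ f z).toContinuousLinearEquivOfDetNeZero (hs z hz) : E →L[ℝ] E) z := by
    simpa using (hf.differentiable one_ne_zero z).hasFDerivAt
  exact ⟨hf.contDiffAt.toOpenPartialHomeomorph f hd one_ne_zero,
    hf.contDiffAt.mem_toOpenPartialHomeomorph_source hd one_ne_zero, rfl⟩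

lemma isLocalHomeomorphOn_of_notMem_criticalSet {f : Plane → Plane} (hf : ContDiff ℝ 1 f)
    {s : Set Plane} (hs : ∀ z ∈ s, z ∉ criticalSet f) : IsLocalHomeomorphOn f s :=
  hf.isLocalHomeomorphOn_of_det_ne_zero hs

/-- Over an open set of values that are neither critical nor cluster values at infinity, `f` is a
proper local homeomorphism, hence a covering map. -/
lemma isCoveringMapOn_of_disjoint {f : Plane → Plane} (hf : ContDiff ℝ 1 f) {F : Set Plane}
    (hF : IsOpen F) (hd : Disjoint F (f '' criticalSet f ∪ clusterSet f)) :
    IsCoveringMapOn f F := by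
  have hdC : Disjoint F (clusterSet f) := hd.mono_right subset_union_right
  have hFo : IsOpen (f ⁻¹' F) := hF.preimage hf.continuous
  refine .of_isCoveringMap_restrictPreimage _ hF hFo ?_
  have hloc : IsLocalHomeomorph (F.restrictPreimage f) := by
    refine IsLocalHomeomorph.of_comp (g := ((↑) : F → Plane)) ?_
      hF.isOpenEmbedding_subtypeVal.isLocalHomeomorph hf.continuous.restrictPreimage
    have h1 : IsLocalHomeomorphOn f (f ⁻¹' F) :=
      isLocalHomeomorphOn_of_notMem_criticalSet hf fun z hz hzS =>
        hd.le_bot ⟨hz, Or.inl ⟨z, hzS, rfl⟩⟩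
    rw [isLocalHomeomorph_iff_isLocalHomeomorphOn_univ]
    exact h1.comp (isLocalHomeomorph_iff_isLocalHomeomorphOn_univ.1
      hFo.isOpenEmbedding_subtypeVal.isLocalHomeomorph) fun z _ => z.2
  have hcpt : ∀ K : Set F, IsCompact K → IsCompact (F.restrictPreimage f ⁻¹' K) := by
    intro K hK
    rw [Subtype.isCompact_iff]
    have : ((↑) : f ⁻¹' F → Plane) '' (F.restrictPreimage f ⁻¹' K) =
        f ⁻¹' (((↑) : F → Plane) '' K) := by
      ext z
      simp
    rw [this]
    refine isCompact_preimage_of_disjoint_clusterSet hf.continuous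
      (hK.image continuous_subtype_val) (hdC.mono_left ?_)
    rintro _ ⟨x, -, rfl⟩
    exact x.2
  have : LocallyCompactSpace F := hF.locallyCompactSpace
  have hprop : IsProperMap (F.restrictPreimage f) :=
    isProperMap_iff_isCompact_preimage.2 ⟨hf.continuous.restrictPreimage, hcpt⟩
  rw [isCoveringMap_iff_isCoveringMapOn_univ]
  refine hprop.isClosedMap.isCoveringMapOn_of_isLocalHomeomorphOn (fun x _ => ?_)
    (by simpa using isLocalHomeomorph_iff_isLocalHomeomorphOn_univ.1 hloc)
  refine (hcpt _ isCompact_singleton).finite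
    (IsDiscrete.of_openPartialHomeomorph (F.restrictPreimage f) subset_rfl fun e _ => ?_)
  obtain ⟨φ, hφ, h⟩ := hloc e
  exact ⟨φ, hφ, h.symm⟩

lemma finite_fiber_of_disjoint {f : Plane → Plane} (hf : ContDiff ℝ 1 f) {w : Plane}
    (hw : w ∉ f '' criticalSet f ∪ clusterSet f) : (f ⁻¹' {w}).Finite := by
  rw [mem_union, not_or] at hw
  refine (isCompact_preimage_of_disjoint_clusterSet hf.continuous isCompact_singleton
    (disjoint_singleton_left.2 hw.2)).finite
    (IsDiscrete.of_openPartialHomeomorph f subset_rfl fun e he => ?_)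
  obtain ⟨φ, hφ, h⟩ := isLocalHomeomorphOn_of_notMem_criticalSet hf (s := f ⁻¹' {w})
    (fun z hz hzS => hw.1 ⟨z, hzS, hz⟩) e he
  exact ⟨φ, hφ, h.symm⟩

/-- A fibre without critical points is discrete, hence countable. -/
lemma countable_fiber {f : Plane → Plane} (hf : ContDiff ℝ 1 f) {w : Plane}
    (hw : w ∉ f '' criticalSet f) : (f ⁻¹' {w}).Countable := by
  have hdis : IsDiscrete (f ⁻¹' {w}) :=
    IsDiscrete.of_openPartialHomeomorph f subset_rfl fun e he => by
      obtain ⟨φ, hφ, h⟩ := isLocalHomeomorphOn_of_notMem_criticalSet hf (s := f ⁻¹' {w})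
        (fun z hz hzS => hw ⟨z, hzS, hz⟩) e he
      exact ⟨φ, hφ, h.symm⟩
  have : DiscreteTopology (f ⁻¹' {w}) := hdis.1
  exact TopologicalSpace.separableSpace_iff_countable.1 inferInstance

/-! ### Lifting a curve through a covering with finite fibres -/

/-- If points `z n` lie over `β n` for a curve `β` in the base of a covering with finite fibres,
then a single lift of `β` passes through infinitely many of them: the lift through `z n` is
determined by its value at time `0`, for which there are finitely many possibilities. -/
lemma IsCoveringMapOn.exists_lift_frequently_eq {E X : Type*} [TopologicalSpace E]
    [TopologicalSpace X] {p : E → X} {F : Set X} (cov : IsCoveringMapOn p F)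
    (hfin : ∀ x ∈ F, (p ⁻¹' {x}).Finite) (β : C(ℝ, X)) (hβ : ∀ t, β t ∈ F)
    {z : ℕ → E} (hz : ∀ n : ℕ, p (z n) = β n) :
    ∃ γ : C(ℝ, E), (∀ t, p (γ t) = β t) ∧ ∃ᶠ n : ℕ in atTop, γ n = z n := by
  choose Γ hΓ _ using fun n : ℕ => cov.existsUnique_continuousMap_lifts β (hz n) hβ
  have hΓβ : ∀ n t, p (Γ n t) = β t := fun n t => congrFun (hΓ n).2 t
  have hmem : ∃ᶠ n : ℕ in atTop, ∃ e ∈ p ⁻¹' {β 0}, Γ n 0 = e :=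
    Frequently.of_forall fun n => ⟨Γ n 0, hΓβ n 0, rfl⟩
  obtain ⟨e, he, hfreq⟩ := (frequently_exists_finite (hfin _ (hβ 0))).1 hmem
  obtain ⟨γ, ⟨-, hγ⟩, huniq⟩ := cov.existsUnique_continuousMap_lifts β (e₀ := e) he hβ
  refine ⟨γ, congrFun hγ, hfreq.mono fun n hn => ?_⟩
  rw [← huniq (Γ n) ⟨hn, (hΓ n).2⟩]
  exact (hΓ n).1

/-! ### Curves accumulating at infinity -/

/-- A curve in the plane that meets every neighbourhood of infinity, and along which `f` tends to a
value with countable fibre, tends to infinity: otherwise it would cross infinitely often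
a circle that misses the fibre, and the crossings would accumulate at a point of the fibre. -/
lemma tendsto_cobounded_of_countable_fiber {f : Plane → Plane} (hf : Continuous f) {w : Plane}
    (hw : (f ⁻¹' {w}).Countable) {γ : ℝ → Plane} (hγ : Continuous γ)
    (hlim : Tendsto (fun t => f (γ t)) atTop (𝓝 w))
    (hfar : ∀ R : ℝ, ∃ᶠ t in atTop, R < ‖γ t‖) :
    Tendsto γ atTop (Bornology.cobounded Plane) := by
  rw [← tendsto_norm_atTop_iff_cobounded, tendsto_atTop]
  intro R
  by_contra hR
  have hnear : ∃ᶠ t in atTop, ‖γ t‖ < R := by simpa [Filter.Frequently] using hR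
  obtain ⟨r, hr, hRr⟩ : ∃ r ∈ (norm '' (f ⁻¹' {w}))ᶜ, R < r := by
    obtain ⟨r, hRr, hr⟩ := ((hw.image norm).dense_compl ℝ).exists_gt R
    exact ⟨r, hRr, hr⟩
  have hcross : ∃ᶠ t in atTop, ‖γ t‖ = r := by
    rw [frequently_atTop]
    intro a
    obtain ⟨b, hab, hb⟩ := frequently_atTop.1 hnear a
    obtain ⟨c, hbc, hc⟩ := frequently_atTop.1 (hfar r) b
    obtain ⟨t, ht, htr⟩ := intermediate_value_Icc hbc hγ.norm.continuousOn
      ⟨(hb.trans hRr).le, hc.le⟩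
    exact ⟨t, hab.trans ht.1, htr⟩
  obtain ⟨t, ht, htr⟩ := exists_seq_forall_of_frequently hcross
  obtain ⟨x, hx, φ, hφ, hxlim⟩ := (isCompact_sphere (0 : Plane) r).tendsto_subseq
    (x := fun n => γ (t n)) fun n => by simpa using htr n
  refine hr ⟨x, ?_, by simpa using hx⟩
  exact tendsto_nhds_unique ((hf.tendsto x).comp hxlim)
    (hlim.comp (ht.comp hφ.tendsto_atTop))

/-! ### Concatenating small arcs -/

/-- The concatenation of a bi-infinite sequence of paths, each run through in unit time. -/
lemma exists_continuous_concat {X : Type*} [TopologicalSpace X] {x : ℤ → X}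
    (p : ∀ n : ℤ, Path (x n) (x (n + 1))) :
    ∃ β : C(ℝ, X), (∀ t, β t = p ⌊t⌋ ⟨Int.fract t, Int.fract_nonneg t, (Int.fract_lt_one t).le⟩) ∧
      ∀ n : ℤ, β n = x n := by
  let g : ℝ → X := fun t => p ⌊t⌋ ⟨Int.fract t, Int.fract_nonneg t, (Int.fract_lt_one t).le⟩
  have hg0 : ∀ n : ℤ, g n = x n := fun n => by
    have h : (⟨Int.fract (n : ℝ), Int.fract_nonneg _, (Int.fract_lt_one _).le⟩ : unitInterval) =
      0 := Subtype.ext (Int.fract_intCast n)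
    simp only [g, h, Path.source, Int.floor_intCast]
  have hcell : ∀ n : ℤ, EqOn g (fun t => (p n).extend (t - n)) (Icc (n : ℝ) (n + 1)) := by
    intro n t ht
    rcases ht.2.lt_or_eq with h | h
    · have hfl : ⌊t⌋ = n := Int.floor_eq_iff.2 ⟨ht.1, h⟩
      subst hfl
      exact (Path.extend_apply _ ⟨Int.fract_nonneg t, (Int.fract_lt_one t).le⟩).symm
    · have := hg0 (n + 1)
      push_cast at this
      simp [h, this]
  have hcont : Continuous g := by
    refine LocallyFinite.continuous (f := fun n : ℤ => Icc (n : ℝ) (n + 1)) ?_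
      (iUnion_Icc_intCast ℝ) (fun _ => isClosed_Icc) fun n => ?_
    · exact locallyFinite_Icc_of_tendsto tendsto_intCast_atTop_atTop
        (tendsto_atBot_add_const_right _ _ (tendsto_intCast_atBot_iff.2 tendsto_id))
    · exact ContinuousOn.congr ((p n).continuous_extend.comp (by fun_prop)).continuousOn (hcell n)
  exact ⟨⟨g, hcont⟩, fun t => rfl, hg0⟩

/-- Points of a uniformly locally arcwise connected set `V` that converge to `w` lie, along a
subsequence, on a curve in `V` ending at `w`. -/
lemma UniformlyLocallyArcwiseConnected.exists_curve {V : Set Plane}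
    (hV : UniformlyLocallyArcwiseConnected V) {w : Plane} {u : ℕ → Plane} (hu : ∀ n, u n ∈ V)
    (hlim : Tendsto u atTop (𝓝 w)) :
    ∃ φ : ℕ → ℕ, StrictMono φ ∧ ∃ β : C(ℝ, Plane), (∀ t, β t ∈ V) ∧
      Tendsto β atTop (𝓝 w) ∧ ∀ n : ℕ, β n = u (φ n) := by
  choose δ hδ harc using fun n : ℕ => hV (1 / ((n : ℝ) + 1)) Nat.one_div_pos_of_nat
  obtain ⟨φ, hφ, hclose⟩ := extraction_forall_of_eventually'
    (P := fun n k => ∀ m ≥ k, dist (u m) w < δ n / 2) fun n => by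
      obtain ⟨N, hN⟩ := Metric.tendsto_atTop.1 hlim (δ n / 2) (half_pos (hδ n))
      exact ⟨N, fun k hk m hm => hN m (hk.trans hm)⟩
  -- Negative times are only there to make the curve total: it is constant on them.
  have hpath : ∀ n : ℤ, ∃ p : Path (u (φ n.toNat)) (u (φ (n + 1).toNat)),
      range p ⊆ V ∧ Metric.diam (range p) < 1 / ((n.toNat : ℝ) + 1) := by
    intro n
    by_cases heq : u (φ n.toNat) = u (φ (n + 1).toNat)
    · refine ⟨(Path.refl _).cast rfl heq.symm, ?_, ?_⟩
      · rintro _ ⟨t, rfl⟩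
        exact hu _
      · rw [Path.cast_coe, Path.refl_range, Metric.diam_singleton]
        exact Nat.one_div_pos_of_nat
    · have hmono : φ n.toNat ≤ φ (n + 1).toNat := hφ.monotone (by lia)
      obtain ⟨p, -, hpV, hpd⟩ := harc n.toNat _ (hu _) _ (hu _) heq (by
        linarith [dist_triangle_right (u (φ n.toNat)) (u (φ (n + 1).toNat)) w,
          hclose n.toNat _ le_rfl, hclose n.toNat _ hmono])
      exact ⟨p, hpV, hpd⟩
  choose p hpV hpd using hpath
  obtain ⟨β, hβ, hβn⟩ := exists_continuous_concat p
  refine ⟨φ, hφ, β, fun t => hβ t ▸ hpV _ (mem_range_self _), ?_, fun n => by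
    simpa using hβn n⟩
  have hfloor : Tendsto (fun t : ℝ => ⌊t⌋.toNat) atTop atTop :=
    tendsto_atTop.2 fun N => (tendsto_floor_atTop.eventually_ge_atTop (N : ℤ)).mono fun t ht => by
      lia
  have hstart : Tendsto (fun t : ℝ => u (φ ⌊t⌋.toNat)) atTop (𝓝 w) :=
    hlim.comp (hφ.tendsto_atTop.comp hfloor)
  refine hstart.congr_dist (squeeze_zero (fun _ => dist_nonneg) (fun t => ?_)
    (tendsto_one_div_add_atTop_nhds_zero_nat.comp hfloor))
  rw [hβ t]
  refine (Metric.dist_le_diam_of_mem (isCompact_range (p ⌊t⌋).continuous).isBounded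
    ⟨0, (p ⌊t⌋).source⟩ (mem_range_self _)).trans (hpd _).le

/-! ### Density of the regular values -/

/-- By Sard's theorem, the values in `B` that are neither critical nor cluster values at infinity
are dense in `B`, as soon as the cluster set is nowhere dense in `B`. -/
lemma exists_mem_regular {f : Plane → Plane} (hf : ContDiff ℝ 1 f) {B O : Set Plane}
    (hC : IsNowhereDense (clusterSet f ∩ B)) (hO : IsOpen O) (hne : O.Nonempty) (hOB : O ⊆ B) :
    ∃ y ∈ O, y ∈ B \ (f '' criticalSet f ∪ clusterSet f) := by
  have hO' : IsOpen (O \ closure (clusterSet f ∩ B)) := hO.sdiff isClosed_closure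
  have hne' : (O \ closure (clusterSet f ∩ B)).Nonempty := by
    rw [nonempty_iff_ne_empty, Ne, sdiff_eq_empty]
    intro h
    have := interior_maximal h hO
    rw [hC] at this
    exact hne.not_subset_empty this
  have hnull : MeasureTheory.volume (f '' criticalSet f) = 0 :=
    MeasureTheory.addHaar_image_eq_zero_of_det_fderivWithin_eq_zero MeasureTheory.volume
      (fun z _ => (hf.differentiable one_ne_zero z).hasFDerivAt.hasFDerivWithinAt) fun z hz => hz
  obtain ⟨y, hy, hyS⟩ : ((O \ closure (clusterSet f ∩ B)) \ f '' criticalSet f).Nonempty := by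
    rw [nonempty_iff_ne_empty, Ne, sdiff_eq_empty]
    exact fun h => (hO'.measure_pos MeasureTheory.volume hne').ne'
      (MeasureTheory.measure_mono_null h hnull)
  exact ⟨y, hy.1, hOB hy.1, fun h => h.elim hyS fun h' =>
    hy.2 (subset_closure ⟨h', hOB hy.1⟩)⟩

/-- Since the critical set has empty interior and `f` is open off it, the points witnessing that
`w` is a cluster value at infinity can be moved so that they take regular values. -/
lemma frequently_mem_regular {f : Plane → Plane} (hf : ContDiff ℝ 1 f)
    (hS : IsNowhereDense (criticalSet f)) {w : Plane} (hw : w ∈ clusterSet f)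
    {B : Set Plane} (hB : B ∈ 𝓝 w) (hC : IsNowhereDense (clusterSet f ∩ B)) :
    ∃ᶠ z in Bornology.cobounded Plane ⊓ comap f (𝓝 w),
      f z ∈ B \ (f '' criticalSet f ∪ clusterSet f) := by
  rw [(hasBasis_cobounded_norm.inf ((nhds_basis_opens w).comap f)).frequently_iff]
  rintro ⟨R, W⟩ ⟨-, hwW, hW⟩
  obtain ⟨z, hz, hfz⟩ := hw
  have hR : ∀ᶠ n in atTop, R < ‖z n‖ :=
    (tendsto_norm_atTop_iff_cobounded.2 hz).eventually_gt_atTop R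
  obtain ⟨n, hn, hnW⟩ := (hR.and (hfz.eventually
    ((hW.inter isOpen_interior).mem_nhds ⟨hwW, mem_interior_iff_mem_nhds.2 hB⟩))).exists
  have hDo : IsOpen ({x : Plane | R < ‖x‖} ∩ f ⁻¹' (W ∩ interior B)) :=
    (isOpen_lt continuous_const continuous_norm).inter
      ((hW.inter isOpen_interior).preimage hf.continuous)
  obtain ⟨z₁, hz₁, hz₁S⟩ : (({x : Plane | R < ‖x‖} ∩ f ⁻¹' (W ∩ interior B)) \
      criticalSet f).Nonempty := by
    rw [nonempty_iff_ne_empty, Ne, sdiff_eq_empty]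
    intro h
    have := interior_maximal (h.trans subset_closure) hDo
    rw [hS] at this
    exact this ⟨hn, hnW⟩
  obtain ⟨e, he, rfl⟩ := isLocalHomeomorphOn_of_notMem_criticalSet hf (s := {z₁})
    (by rintro _ rfl; exact hz₁S) z₁ rfl
  have hopen := e.isOpen_image_of_subset_source (e.open_source.inter hDo) inter_subset_left
  obtain ⟨_, ⟨x, ⟨-, hxR, hxW⟩, rfl⟩, hreg⟩ := exists_mem_regular hf hC hopen
    ⟨_, z₁, ⟨he, hz₁⟩, rfl⟩ (by
      rintro _ ⟨x, ⟨-, -, hx⟩, rfl⟩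
      exact interior_subset hx.2)
  exact ⟨x, ⟨le_of_lt (show R < ‖x‖ from hxR), hxW.1⟩, hreg⟩

/-- If a set has finitely many components, then points whose images lie frequently in it have
images that lie frequently in one of the components. -/
lemma frequently_mem_component {ι : Type*} {l : Filter ι} {g : ι → Plane} {F : Set Plane}
    (hF : (componentsOf F).Finite) (h : ∃ᶠ z in l, g z ∈ F) :
    ∃ V ∈ componentsOf F, ∃ᶠ z in l, g z ∈ V :=
  (frequently_exists_finite hF).1 <| h.mono fun z hz =>
    ⟨_, ⟨g z, hz, rfl⟩, mem_connectedComponentIn hz⟩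

theorem theorem6 (f : Plane → Plane) (hf : ContDiff ℝ 1 f)
    (hS : IsNowhereDense (criticalSet f))
    (w₀ : Plane) (hw₀ : w₀ ∈ clusterSet f)
    (hval : valence f w₀ < ⊤ ∨ (valence f w₀ = ⊤ ∧ w₀ ∉ f '' criticalSet f))
    (hε : ∃ ε > 0,
      IsNowhereDense (clusterSet f ∩ Metric.ball w₀ ε) ∧
      (componentsOf (Metric.ball w₀ ε \ (f '' criticalSet f ∪ clusterSet f))).Finite ∧
      ∀ V ∈ componentsOf (Metric.ball w₀ ε \ (f '' criticalSet f ∪ clusterSet f)),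
        UniformlyLocallyArcwiseConnected V) :
    IsAsymptoticValue f w₀ := by
  have hcount : (f ⁻¹' {w₀}).Countable := by
    rcases hval with h | ⟨-, h⟩
    · exact (encard_lt_top_iff.1 h).countable
    · exact countable_fiber hf h
  obtain ⟨ε, hε, hC, hfin, hula⟩ := hε
  set F := Metric.ball w₀ ε \ (f '' criticalSet f ∪ clusterSet f) with hFdef
  have hFo : IsOpen F := Metric.isOpen_ball.sdiff (isClosed_image_criticalSet_union_clusterSet hf)
  obtain ⟨V, hV, hfreq⟩ := frequently_mem_component hfin
    (frequently_mem_regular hf hS hw₀ (Metric.ball_mem_nhds w₀ hε) hC)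
  have hVF : V ⊆ F := by
    obtain ⟨x, -, rfl⟩ := hV
    exact connectedComponentIn_subset F x
  obtain ⟨z, hz, hzV⟩ := exists_seq_forall_of_frequently hfreq
  rw [tendsto_inf, tendsto_comap_iff] at hz
  obtain ⟨φ, hφ, β, hβV, hβ, hβz⟩ := (hula V hV).exists_curve hzV hz.2
  obtain ⟨γ, hγ, hγz⟩ := (isCoveringMapOn_of_disjoint hf hFo
    disjoint_sdiff_left).exists_lift_frequently_eq
    (fun x hx => finite_fiber_of_disjoint hf hx.2) β (fun t => hVF (hβV t))
    (z := z ∘ φ) fun n => (hβz n).symm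
  have hlim : Tendsto (fun t => f (γ t)) atTop (𝓝 w₀) := by simpa only [hγ] using hβ
  refine ⟨γ, γ.continuous.continuousOn, tendsto_cobounded_of_countable_fiber hf.continuous hcount
    γ.continuous hlim fun R => ?_, hlim⟩
  have hR : ∀ᶠ n in atTop, R < ‖z (φ n)‖ := (tendsto_norm_atTop_iff_cobounded.2
    (hz.1.comp hφ.tendsto_atTop)).eventually_gt_atTop R
  refine tendsto_natCast_atTop_atTop.frequently ((hγz.and_eventually hR).mono ?_)
  rintro n ⟨h1, h2⟩
  rw [h1]
  exact h2
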